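/- Let $\mathsf{RC}$ be the (variable-free) reflection calculus: its formulas are built by $\top \mid \varphi\wedge\psi \mid \langle\lambda\rangle\varphi$ with $\lambda$ an arbitrary ordinal, and it derives sequents $\varphi\Rightarrow\psi$ by the axioms and rules - $\varphi\Rightarrow\varphi$; $\ \varphi\Rightarrow\top$; $\ \varphi\wedge\psi\Rightarrow\varphi$; $\ \varphi\wedge\psi\Rightarrow\psi$; - from $\varphi\Rightarrow\psi$ and $\psi\Rightarrow\theta$ infer $\varphi\Rightarrow\theta$; from $\varphi\Rightarrow\psi$ and $\varphi\Rightarrow\theta$ infer $\varphi\Rightarrow\psi\wedge\theta$; - $\langle\lambda\rangle\langle\lambda\rangle\varphi\Rightarrow\langle\lambda\rangle\varphi$; from $\varphi\Rightarrow\psi$ infer $\langle\lambda\rangle\varphi\Rightarrow\langle\lambda\rangle\psi$; - $\langle\lambda\rangle\varphi\Rightarrow\langle\mu\rangle\varphi$ for $\mu\le\lambda$; $\ \langle\lambda\rangle\varphi\wedge\langle\mu\rangle\psi\Rightarrow\langle\lambda\rangle(\varphi\wedge\langle\mu\rangle\psi)$ for $\mu<\lambda$. A worm is a formula $\mathfrak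 w=\langle\lambda_1\rangle\cdots\langle\lambda_n\rangle\top$ with $n\ge 0$ and $\lambda_1,\dots,\lambda_n$ ordinals. For worms $\mathfrak v,\mathfrak w$ put $\mathfrak v\trianglelefteq\mathfrak w$ if $\mathsf{RC}\vdash\mathfrak w\Rightarrow\langle 0\rangle\mathfrak v$, or if both $\mathsf{RC}\vdash\mathfrak v\Rightarrow\mathfrak w$ and $\mathsf{RC}\vdash\mathfrak w\Rightarrow\mathfrak v$. This is a pre-well-order on the class of worms; let $\triangleleft$ be its strict part and let $o(\mathfrak w)=\bigcup_{\mathfrak v\,\triangleleft\,\mathfrak w}(o(\mathfrak v)+1)$ be the order-type of $\mathfrak w$ in it. Let $\mathsf W$ be the set of autonomous worms, i.e. the least set of expressions such that $\top\in\mathsf W$ and $(\mathtt w)\mathtt v\in\mathsf W$ whenever $\mathtt w,\mathtt v\in\mathsf W$. Interpret autonomous worms as worms recursively by $\top^*=\top$ and $((\mathtt w)\mathtt v)^*=\langle o(\mathtt w^*)\rangle\,\mathtt v^*$, and put $\mathsf o(\mathtt w)=o(\mathtt w^*)$. Let $\Gamma_0$ be the Feferman–Schütte ordinal, i.e. the least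 ordinal $\alpha$ with $\varphi_\alpha(0)=\alpha$, where $\varphi_\alpha$ are the Veblen functions with $\varphi_0(\beta)=\omega^\beta$. **Theorem.** For every ordinal $\gamma$, $\gamma<\Gamma_0$ if and only if there is $\mathtt w\in\mathsf W$ such that $\gamma=\mathsf o(\mathtt w)$. -/

import Mathlib

open scoped Ordinal

universe u

namespace ReflectionCalculus

/-- Formulas of the (variable-free) reflection calculus `RC`, with one modality `⟨l⟩` for
each ordinal `l`. -/
inductive Formula : Type (u + 1)
  | top : Formula
  | and (φ ψ : Formula) : Formula
  | dia (l : Ordinal.{u}) (φ : Formula) : Formula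

/-- `Derives φ ψ`: the sequent `φ ⇒ ψ` is derivable in `RC`. -/
inductive Derives : Formula.{u} → Formula.{u} → Prop
  | refl (φ : Formula.{u}) : Derives φ φ
  | top (φ : Formula.{u}) : Derives φ Formula.top
  | trans {φ ψ θ : Formula.{u}} : Derives φ ψ → Derives ψ θ → Derives φ θ
  | and_left (φ ψ : Formula.{u}) : Derives (φ.and ψ) φ
  | and_right (φ ψ : Formula.{u}) : Derives (φ.and ψ) ψ
  | and_intro {φ ψ θ : Formula.{u}} : Derives φ ψ → Derives φ θ → Derives φ (ψ.and θ)
  | dia_dia (l : Ordinal.{u}) (φ : Formula.{u}) :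
      Derives (Formula.dia l (Formula.dia l φ)) (Formula.dia l φ)
  | dia_mono (l : Ordinal.{u}) {φ ψ : Formula.{u}} :
      Derives φ ψ → Derives (Formula.dia l φ) (Formula.dia l ψ)
  | dia_le {m l : Ordinal.{u}} (h : m ≤ l) (φ : Formula.{u}) :
      Derives (Formula.dia l φ) (Formula.dia m φ)
  | dia_and {m l : Ordinal.{u}} (h : m < l) (φ ψ : Formula.{u}) :
      Derives ((Formula.dia l φ).and (Formula.dia m ψ)) (Formula.dia l (φ.and (Formula.dia m ψ)))

/-- A worm `l₁ … lₙ ⊤`, represented by the list `[l₁, …, lₙ]` of its entries. -/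
abbrev Worm : Type (u + 1) := List Ordinal.{u}

/-- The formula `⟨l₁⟩ … ⟨lₙ⟩ ⊤` that the list `[l₁, …, lₙ]` stands for. -/
def Worm.toFormula : Worm.{u} → Formula.{u}
  | [] => Formula.top
  | l :: w => Formula.dia l (Worm.toFormula w)

/-- `WormLt l v w`: the relation `v ◁_l w`, i.e. `RC ⊢ w ⇒ ⟨l⟩ v`. -/
def WormLt (l : Ordinal.{u}) (v w : Worm.{u}) : Prop :=
  Derives (Worm.toFormula w) (Formula.dia l (Worm.toFormula v))

/-- Equivalence of worms, provably in `RC`. -/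
def WormEquiv (v w : Worm.{u}) : Prop :=
  Derives (Worm.toFormula v) (Worm.toFormula w) ∧ Derives (Worm.toFormula w) (Worm.toFormula v)

/-- `WormLe l v w`: the relation `v ⊴_l w`, i.e. `v ◁_l w` or `v ≡ w`. -/
def WormLe (l : Ordinal.{u}) (v w : Worm.{u}) : Prop :=
  WormLt l v w ∨ WormEquiv v w

/-- The strict part of a relation `le`. -/
def StrictPart {α : Type*} (le : α → α → Prop) (a b : α) : Prop :=
  le a b ∧ ¬ le b a

/-- The ordinal `⋃_{b ≺ a} (o(b) + 1)`, computed by recursion along the relation `≺` below an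
element `a` which is accessible for it. -/
noncomputable def accRank {α : Type*} {lt : α → α → Prop} {a : α} (h : Acc lt a) :
    Ordinal.{u} :=
  Acc.rec (motive := fun _ _ => Ordinal.{u})
    (fun a _ ih => ⨆ b : {b : α // lt b a}, (ih b.1 b.2 + 1)) h

open Classical in
/-- The order-type function `o(a) = ⋃_{b ≺ a} (o(b) + 1)` of a pre-well-order, with `≺` its strict
part. In a pre-well-order every element is accessible for `≺`, so that the second case does
not arise. -/
noncomputable def orderRank {α : Type*} (le : α → α → Prop) (a : α) : Ordinal.{u} :=
  if h : Acc (StrictPart le) a then accRank h else 0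

/-- The order-type `o(w)` of a worm `w` in the class of all worms, pre-well-ordered by `⊴_0`. All
entries of a worm below `w` are at most the largest entry of `w`, so the worms below `w` form a
small set and the supremum is again an ordinal of the same universe. -/
noncomputable def Worm.o (w : Worm.{u}) : Ordinal.{u} :=
  orderRank (WormLe 0) w

/-- Autonomous worms: generated by `⊤` and `(w)v`. -/
inductive AutWorm : Type
  | top : AutWorm
  | paren (w v : AutWorm) : AutWorm

/-- The interpretation of autonomous worms as worms: `⊤` is interpreted as `⊤`, and `(w)v` as
`⟨o(w*)⟩ v*`, where `w*` and `v*` interpret `w` and `v`. -/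
noncomputable def AutWorm.toWorm : AutWorm → Worm.{u}
  | AutWorm.top => []
  | AutWorm.paren w v => Worm.o (AutWorm.toWorm w) :: AutWorm.toWorm v

/-- The ordinal denoted by an autonomous worm. -/
noncomputable def AutWorm.o (w : AutWorm) : Ordinal.{u} :=
  Worm.o (AutWorm.toWorm w)

end ReflectionCalculus

/-!
The relation `v ◁ w`, i.e. `RC ⊢ w ⇒ ⟨0⟩v`, is shown to coincide with `ord v < ord w` for an
explicit function `ord` from the worms onto all ordinals; then `o(w) = ord w`.

*The function `ord`.* The hyperexponentials `e^l` are compositions of Veblen functions: `e^(ω ^ a)`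
is `φ_a` with its argument shifted by one, and `e^(l + m) = e^l ∘ e^m` (`hyperexp_add`; the absorption
of smaller terms in `l + m` matches `φ_a ∘ φ_b = φ_b` for `a < b`). Adding `k` on the left to all
entries of a worm applies `e^k` to `ord` (`Worm.ord_shift`), and a worm `(1 ↑ v) 0 w` has the value
`ord w + ω ^ ord v` (`Worm.ord_append`). These two equations determine `ord`. It is onto, because a
non-zero ordinal is either a sum `a + ω ^ y` with smaller `a` and `y`, or a Veblen value `φ_a(d)`
with `a ≠ 0` and smaller `d` (`Worm.ord_surjective`).

*Derivability follows the order.* By induction on the joint length, any two worms satisfy `v ◁ w`,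
`v ≡ w` or `w ◁ v`, together with the corresponding relation between their values
(`Worm.comparable`). This uses only the existence of derivations in `RC`.

*The converse* then needs no more than the underivability of `w ⇒ ⟨0⟩w` (`not_wormLt_self`). A worm
`w` of length `n` is true at the root of a finite frame on `0, …, n` satisfying the frame conditions
of `RC`, and an induction on `n` shows that `w` is true at no position reachable from the root.

*Autonomous worms.* `Γ₀` is closed under addition and the Veblen functions, so worms with entries
below `Γ₀` have order-types below `Γ₀` (`Worm.ord_lt_gamma_zero`). Conversely, if `ord w < Γ₀`, then
every entry `l` of `w` satisfies `l < e^l(1) = ord ⟨l⟩⊤ ≤ ord w`, since a fixed point of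
`l ↦ e^l(1)` is at least `Γ₀` (`lt_hyperexp_one_of_lt_gamma_zero`). Hence by induction all entries of
`w` are denoted by autonomous worms, and so is `ord w`.
-/

namespace ReflectionCalculus

/-! ### Finite frames and irreflexivity -/

/-- The accessibility relation for the modality `⟨m⟩` on the positions `a, …, b`, where `lam k` is
the label of the step from `k - 1` to `k`. On these positions it is the least family of relations
which contains `k - 1 → k` for `m ≤ lam k` and makes the frame conditions of `RC` true: a step
forward from `i` to `k` needs labels `≥ m` in between, a step back needs labels `> m` on all of
`k, …, i`. -/
def LineRel (lam : ℕ → Ordinal.{u}) (a b : ℕ) (m : Ordinal.{u}) (i k : ℕ) : Prop :=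
  a < k ∧ k ≤ b ∧
    ((i < k ∧ ∀ j, i < j → j ≤ k → m ≤ lam j) ∨ (k ≤ i ∧ ∀ j, k ≤ j → j ≤ i → m < lam j))

/-- Truth of a formula at a position of the frame on `a, …, b`. -/
def LineSat (lam : ℕ → Ordinal.{u}) (a b : ℕ) : Formula.{u} → ℕ → Prop
  | Formula.top, _ => True
  | Formula.and φ ψ, i => LineSat lam a b φ i ∧ LineSat lam a b ψ i
  | Formula.dia m φ, i => ∃ k, LineRel lam a b m i k ∧ LineSat lam a b φ k

section Frames

variable {lam : ℕ → Ordinal.{u}} {a b : ℕ}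

theorem LineRel.mono {m l : Ordinal.{u}} (h : m ≤ l) {i k : ℕ} (hR : LineRel lam a b l i k) :
    LineRel lam a b m i k := by
  obtain ⟨ha, hb, ⟨hik, hl⟩ | ⟨hki, hl⟩⟩ := hR
  · exact ⟨ha, hb, Or.inl ⟨hik, fun j h1 h2 => h.trans (hl j h1 h2)⟩⟩
  · exact ⟨ha, hb, Or.inr ⟨hki, fun j h1 h2 => h.trans_lt (hl j h1 h2)⟩⟩

theorem LineRel.trans {m : Ordinal.{u}} {i j k : ℕ} (h₁ : LineRel lam a b m i j)
    (h₂ : LineRel lam a b m j k) : LineRel lam a b m i k := by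
  obtain ⟨-, -, h₁⟩ := h₁
  obtain ⟨ha, hb, h₂⟩ := h₂
  refine ⟨ha, hb, ?_⟩
  rcases h₁ with ⟨hij, h₁⟩ | ⟨hji, h₁⟩ <;> rcases h₂ with ⟨hjk, h₂⟩ | ⟨hkj, h₂⟩
  · refine Or.inl ⟨hij.trans hjk, fun x hx hx' => ?_⟩
    rcases le_or_gt x j with hxj | hxj
    · exact h₁ x hx hxj
    · exact h₂ x hxj hx'
  · rcases lt_or_ge i k with hik | hki
    · exact Or.inl ⟨hik, fun x hx hx' => h₁ x hx (hx'.trans hkj)⟩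
    · exact Or.inr ⟨hki, fun x hx hx' => h₂ x hx (hx'.trans hij.le)⟩
  · rcases lt_or_ge i k with hik | hki
    · exact Or.inl ⟨hik, fun x hx hx' => h₂ x (hji.trans_lt hx) hx'⟩
    · exact Or.inr ⟨hki, fun x hx hx' => h₁ x (hjk.le.trans hx) hx'⟩
  · refine Or.inr ⟨hkj.trans hji, fun x hx hx' => ?_⟩
    rcases le_or_gt x j with hxj | hxj
    · exact h₂ x hx hxj
    · exact h₁ x hxj.le hx'

/-- The frame condition for `⟨l⟩φ ∧ ⟨m⟩ψ ⇒ ⟨l⟩(φ ∧ ⟨m⟩ψ)`. -/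
theorem LineRel.euclid {m l : Ordinal.{u}} (hml : m < l) {i j k : ℕ}
    (h₁ : LineRel lam a b l i j) (h₂ : LineRel lam a b m i k) : LineRel lam a b m j k := by
  obtain ⟨-, -, h₁⟩ := h₁
  obtain ⟨ha, hb, h₂⟩ := h₂
  refine ⟨ha, hb, ?_⟩
  rcases h₁ with ⟨hij, h₁⟩ | ⟨hji, h₁⟩ <;> rcases h₂ with ⟨hik, h₂⟩ | ⟨hki, h₂⟩
  · rcases lt_or_ge j k with hjk | hkj
    · exact Or.inl ⟨hjk, fun x hx hx' => h₂ x (hij.trans hx) hx'⟩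
    · exact Or.inr ⟨hkj, fun x hx hx' => hml.trans_le (h₁ x (hik.trans_le hx) hx')⟩
  · refine Or.inr ⟨hki.trans hij.le, fun x hx hx' => ?_⟩
    rcases le_or_gt x i with hxi | hxi
    · exact h₂ x hx hxi
    · exact hml.trans_le (h₁ x hxi hx')
  · refine Or.inl ⟨hji.trans_lt hik, fun x hx hx' => ?_⟩
    rcases le_or_gt x i with hxi | hxi
    · exact (hml.trans (h₁ x hx.le hxi)).le
    · exact h₂ x hxi hx'
  · rcases lt_or_ge j k with hjk | hkj
    · exact Or.inl ⟨hjk, fun x hx hx' => (hml.trans (h₁ x hx.le (hx'.trans hki))).le⟩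
    · exact Or.inr ⟨hkj, fun x hx hx' => h₂ x hx (hx'.trans hji)⟩

theorem Derives.lineSat {φ ψ : Formula.{u}} (h : Derives φ ψ) {i : ℕ}
    (hi : LineSat lam a b φ i) : LineSat lam a b ψ i := by
  induction h generalizing i with
  | refl => exact hi
  | top => exact trivial
  | trans _ _ ih₁ ih₂ => exact ih₂ (ih₁ hi)
  | and_left => exact hi.1
  | and_right => exact hi.2
  | and_intro _ _ ih₁ ih₂ => exact ⟨ih₁ hi, ih₂ hi⟩
  | dia_dia =>
    obtain ⟨k, hk, k', hk', h⟩ := hi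
    exact ⟨k', hk.trans hk', h⟩
  | dia_mono _ _ ih =>
    obtain ⟨k, hk, h⟩ := hi
    exact ⟨k, hk, ih h⟩
  | dia_le hml =>
    obtain ⟨k, hk, h⟩ := hi
    exact ⟨k, hk.mono hml, h⟩
  | dia_and hml =>
    obtain ⟨⟨j, hj, h⟩, k, hk, h'⟩ := hi
    exact ⟨j, hj, h, k, hj.euclid hml hk, h'⟩

/-- The worm `⟨lam (a + 1)⟩ … ⟨lam (a + n)⟩ ⊤` of the labels behind position `a`. -/
def lineWorm (lam : ℕ → Ordinal.{u}) (a n : ℕ) : Worm.{u} :=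
  (List.range' (a + 1) n).map lam

theorem lineSat_lineWorm (n : ℕ) (h : a + n ≤ b) {c : ℕ} (hc : c ≤ a) :
    LineSat lam c b (lineWorm lam a n).toFormula a := by
  induction n generalizing a with
  | zero => exact trivial
  | succ n ih =>
    refine ⟨a + 1, ⟨by omega, by omega, Or.inl ⟨by omega, fun j h1 h2 => ?_⟩⟩,
      ih (a := a + 1) (by omega) (by omega)⟩
    rw [show j = a + 1 by omega]

theorem LineSat.of_append {v w : Worm.{u}} {i : ℕ}
    (h : LineSat lam a b (Worm.toFormula (v ++ w)) i) : LineSat lam a b (Worm.toFormula v) i := by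
  induction v generalizing i with
  | nil => exact trivial
  | cons l v ih =>
    obtain ⟨k, hk, h⟩ := h
    exact ⟨k, hk, ih h⟩

theorem LineSat.exists_of_append {v w : Worm.{u}} {i : ℕ}
    (h : LineSat lam a b (Worm.toFormula (v ++ w)) i) :
    ∃ k, LineSat lam a b (Worm.toFormula w) k := by
  induction v generalizing i with
  | nil => exact ⟨i, h⟩
  | cons l v ih =>
    obtain ⟨k, -, h⟩ := h
    exact ih h

/-- Steps for labels `≥ lam p` do not leave the positions `≥ p`. -/
theorem LineSat.restrict_right {p : ℕ} {w : Worm.{u}} (hw : ∀ x ∈ w, lam p ≤ x) {i : ℕ}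
    (hi : p ≤ i) (h : LineSat lam a b w.toFormula i) : LineSat lam p b w.toFormula i := by
  induction w generalizing i with
  | nil => exact trivial
  | cons l w ih =>
    obtain ⟨k, ⟨-, hkb, hR⟩, h⟩ := h
    have hl : lam p ≤ l := hw l (by simp)
    have hpk : p < k := by
      rcases hR with ⟨hik, -⟩ | ⟨hki, hR⟩
      · omega
      · by_contra hkp
        exact (hl.trans_lt (hR p (by omega) hi)).false
    exact ⟨k, ⟨hpk, hkb, hR⟩, ih (fun x hx => hw x (by simp [hx])) hpk.le h⟩

/-- Steps for labels `> lam p` do not lead from a position `< p` to one `≥ p`. -/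
theorem LineSat.restrict_left {p : ℕ} {w : Worm.{u}} (hw : ∀ x ∈ w, lam p < x) {i : ℕ}
    (hi : i < p) (h : LineSat lam a b w.toFormula i) :
    LineSat lam a (p - 1) w.toFormula i := by
  induction w generalizing i with
  | nil => exact trivial
  | cons l w ih =>
    obtain ⟨k, ⟨hak, -, hR⟩, h⟩ := h
    have hl : lam p < l := hw l (by simp)
    have hkp : k < p := by
      rcases hR with ⟨hik, hR⟩ | ⟨hki, hR⟩
      · by_contra hkp
        exact (hl.trans_le (hR p hi (by omega))).false
      · omega
    exact ⟨k, ⟨hak, by omega, hR⟩, ih (fun x hx => hw x (by simp [hx])) hkp h⟩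

/-- The worm `w` read off the frame does not hold at any position which is reachable from the root.
Let `p` be the first step with the least label. A path for `w` from a position `≥ p` stays there and
contains a path for the part of `w` behind `p`. A path for `w` from a position between the root and
`p` begins with a path, not crossing `p`, for the part of `w` before `p`. Both contradict the
claim for a shorter worm. -/
theorem not_lineSat_lineWorm (n : ℕ) (a i : ℕ) (hai : a < i) (hi : i ≤ a + n) :
    ¬ LineSat lam a (a + n) (lineWorm lam a n).toFormula i := by
  induction n using Nat.strong_induction_on generalizing a i with
  | _ n ih =>
  intro h
  have hex : ∃ p, a < p ∧ p ≤ a + n ∧ ∀ j, a < j → j ≤ a + n → lam p ≤ lam j := by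
    obtain ⟨p, hp, hmin⟩ := Finset.exists_min_image (Finset.Ioc a (a + n)) lam
      ⟨i, Finset.mem_Ioc.2 ⟨hai, hi⟩⟩
    rw [Finset.mem_Ioc] at hp
    exact ⟨p, hp.1, hp.2, fun j h1 h2 => hmin j (Finset.mem_Ioc.2 ⟨h1, h2⟩)⟩
  classical
  obtain ⟨hap, hpn, hmin⟩ := Nat.find_spec hex
  have hfirst : ∀ j, a < j → j < Nat.find hex → lam (Nat.find hex) < lam j := by
    intro j h1 h2
    by_contra hj
    exact Nat.find_min hex h2 ⟨h1, by omega, fun k hk hk' => (not_lt.1 hj).trans (hmin k hk hk')⟩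
  generalize Nat.find hex = p at hap hpn hmin hfirst
  obtain ⟨c, rfl⟩ : ∃ c, p = a + c + 1 := ⟨p - a - 1, by omega⟩
  obtain ⟨d, rfl⟩ : ∃ d, n = c + 1 + d := ⟨n - c - 1, by omega⟩
  have hsplit : lineWorm lam a (c + 1 + d) =
      lineWorm lam a c ++ lam (a + c + 1) :: lineWorm lam (a + c + 1) d := by
    have h1 : List.range' (a + 1) (c + 1 + d) =
        List.range' (a + 1) c ++ (a + c + 1) :: List.range' (a + c + 1 + 1) d := by
      rw [← List.range'_succ, show a + c + 1 = a + 1 + c by omega, List.range'_append_1]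
      congr 1
      omega
    simp [lineWorm, h1]
  have hlabels : ∀ x ∈ lineWorm lam a (c + 1 + d), lam (a + c + 1) ≤ x := by
    intro x hx
    simp only [lineWorm, List.mem_map, List.mem_range'_1] at hx
    obtain ⟨j, hj, rfl⟩ := hx
    exact hmin j (by omega) (by omega)
  rcases lt_or_ge i (a + c + 1) with hip | hip
  · refine ih c (by omega) a i hai (by omega) ?_
    rw [hsplit] at h
    refine LineSat.restrict_left (p := a + c + 1) (fun x hx => ?_) hip h.of_append
    simp only [lineWorm, List.mem_map, List.mem_range'_1] at hx
    obtain ⟨j, hj, rfl⟩ := hx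
    exact hfirst j (by omega) (by omega)
  · have h' := LineSat.restrict_right hlabels hip h
    rw [hsplit] at h'
    obtain ⟨k, k', ⟨h1, h2, -⟩, h3⟩ := h'.exists_of_append
    refine ih d (by omega) (a + c + 1) k' h1 (by omega) ?_
    rwa [show a + c + 1 + d = a + (c + 1 + d) by omega]

end Frames

/-- No worm implies its own consistency. -/
theorem not_wormLt_self (w : Worm.{u}) : ¬ WormLt 0 w w := by
  intro h
  let lam : ℕ → Ordinal.{u} := fun k => w.getD (k - 1) 0
  have hw : lineWorm lam 0 w.length = w := by
    apply List.ext_getElem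
    · simp [lineWorm]
    · intro i h1 h2
      simp [lineWorm, lam, h2]
  have h0 := lineSat_lineWorm (lam := lam) (a := 0) (b := 0 + w.length) (c := 0) w.length le_rfl
    le_rfl
  rw [hw] at h0
  obtain ⟨k, ⟨h1, h2, -⟩, h3⟩ := h.lineSat h0
  have := not_lineSat_lineWorm (lam := lam) w.length 0 k h1 h2
  rw [hw] at this
  exact this h3

/-! ### Hyperexponentials -/

/-- The function `e^(ω ^ a)`: the Veblen function `φ_a` with its argument shifted by one, so that
`0` is fixed; `e^1` is `x ↦ -1 + ω ^ x`. Ordinal subtraction is left subtraction,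
`1 + (x - 1) = x` for `x ≠ 0`. -/
noncomputable def shiftedVeblen (a x : Ordinal.{u}) : Ordinal.{u} :=
  if x = 0 then 0 else if a = 0 then ω ^ x else Ordinal.veblen a (x - 1)

theorem shiftedVeblen_zero_right (a : Ordinal.{u}) : shiftedVeblen a 0 = 0 := by
  simp [shiftedVeblen]

theorem shiftedVeblen_zero_left {x : Ordinal.{u}} (hx : x ≠ 0) : shiftedVeblen 0 x = ω ^ x := by
  simp [shiftedVeblen, hx]

theorem shiftedVeblen_one_add {a : Ordinal.{u}} (ha : a ≠ 0) (x : Ordinal.{u}) :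
    shiftedVeblen a (1 + x) = Ordinal.veblen a x := by
  have : (1 + x : Ordinal.{u}) ≠ 0 := by simp
  rw [shiftedVeblen, if_neg this, if_neg ha, Ordinal.add_sub_cancel]

theorem shiftedVeblen_of_one_add_eq (a : Ordinal.{u}) {x : Ordinal.{u}} (hx : 1 + x = x) :
    shiftedVeblen a x = Ordinal.veblen a x := by
  rcases eq_or_ne a 0 with rfl | ha
  · have h0 : x ≠ 0 := by
      rintro rfl
      simp at hx
    rw [shiftedVeblen_zero_left h0, Ordinal.veblen_zero_apply]
  · rw [← shiftedVeblen_one_add ha, hx]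

theorem exists_eq_one_add {x : Ordinal.{u}} (hx : x ≠ 0) : ∃ y, x = 1 + y :=
  ⟨x - 1, (Ordinal.add_sub_cancel_of_le (Order.one_le_iff_ne_zero.2 hx)).symm⟩

theorem strictMono_shiftedVeblen (a : Ordinal.{u}) : StrictMono (shiftedVeblen a) := by
  intro x y hxy
  have hy : y ≠ 0 := hxy.ne_bot
  rcases eq_or_ne a 0 with rfl | ha
  · rw [shiftedVeblen_zero_left hy]
    rcases eq_or_ne x 0 with rfl | hx
    · rw [shiftedVeblen_zero_right]
      exact Ordinal.opow_pos _ Ordinal.omega0_pos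
    · rw [shiftedVeblen_zero_left hx]
      exact (Ordinal.opow_lt_opow_iff_right Ordinal.one_lt_omega0).2 hxy
  · obtain ⟨y, rfl⟩ := exists_eq_one_add hy
    rw [shiftedVeblen_one_add ha]
    rcases eq_or_ne x 0 with rfl | hx
    · rw [shiftedVeblen_zero_right]
      exact Ordinal.veblen_pos
    · obtain ⟨x, rfl⟩ := exists_eq_one_add hx
      rw [shiftedVeblen_one_add ha]
      exact Ordinal.veblen_lt_veblen_iff_right.2 (by simpa using hxy)

theorem opow_veblen {a : Ordinal.{u}} (ha : a ≠ 0) (x : Ordinal.{u}) :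
    ω ^ Ordinal.veblen a x = Ordinal.veblen a x := by
  rw [← Ordinal.veblen_zero_apply, Ordinal.veblen_veblen_of_lt (pos_iff_ne_zero.2 ha)]

theorem one_lt_omega0_opow_of_ne_zero {x : Ordinal.{u}} (hx : x ≠ 0) :
    (1 : Ordinal.{u}) < ω ^ x := by
  rw [← Ordinal.opow_zero ω, Ordinal.opow_lt_opow_iff_right Ordinal.one_lt_omega0]
  exact pos_iff_ne_zero.2 hx

theorem one_add_veblen {a : Ordinal.{u}} (ha : a ≠ 0) (x : Ordinal.{u}) :
    1 + Ordinal.veblen a x = Ordinal.veblen a x := by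
  rw [← opow_veblen ha]
  exact (Ordinal.isPrincipal_add_omega0_opow _).add_eq_right
    (one_lt_omega0_opow_of_ne_zero Ordinal.veblen_pos.ne')

theorem shiftedVeblen_shiftedVeblen {a b : Ordinal.{u}} (hab : a < b) (x : Ordinal.{u}) :
    shiftedVeblen a (shiftedVeblen b x) = shiftedVeblen b x := by
  rcases eq_or_ne x 0 with rfl | hx
  · simp only [shiftedVeblen_zero_right]
  · obtain ⟨x, rfl⟩ := exists_eq_one_add hx
    rw [shiftedVeblen_one_add hab.ne_bot,
      shiftedVeblen_of_one_add_eq a (one_add_veblen hab.ne_bot x), Ordinal.veblen_veblen_of_lt hab]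

/-- The hyperexponential `e^l`: for `l = ω ^ a₁ + ⋯ + ω ^ aₙ` in Cantor normal form the composition
of the `e^(ω ^ aᵢ)`, the outermost first. -/
noncomputable def hyperexp (l x : Ordinal.{u}) : Ordinal.{u} :=
  if _ : l = 0 then x
  else shiftedVeblen (Ordinal.log ω l) (hyperexp (l - ω ^ Ordinal.log ω l) x)
termination_by l
decreasing_by exact Ordinal.sub_omega0_opow_log_lt ‹_›

theorem hyperexp_zero_left (x : Ordinal.{u}) : hyperexp 0 x = x := by
  rw [hyperexp, dif_pos rfl]

theorem hyperexp_of_ne_zero {l : Ordinal.{u}} (h : l ≠ 0) (x : Ordinal.{u}) :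
    hyperexp l x = shiftedVeblen (Ordinal.log ω l) (hyperexp (l - ω ^ Ordinal.log ω l) x) := by
  rw [hyperexp, dif_neg h]

theorem strictMono_hyperexp (l : Ordinal.{u}) : StrictMono (hyperexp l) := by
  induction l using WellFoundedLT.induction with
  | _ l ih =>
  rcases eq_or_ne l 0 with rfl | hl
  · exact fun x y h => by simpa only [hyperexp_zero_left] using h
  · intro x y h
    rw [hyperexp_of_ne_zero hl, hyperexp_of_ne_zero hl]
    exact strictMono_shiftedVeblen _ (ih _ (Ordinal.sub_omega0_opow_log_lt hl) h)

theorem hyperexp_zero_right (l : Ordinal.{u}) : hyperexp l 0 = 0 := by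
  induction l using WellFoundedLT.induction with
  | _ l ih =>
  rcases eq_or_ne l 0 with rfl | hl
  · exact hyperexp_zero_left 0
  · rw [hyperexp_of_ne_zero hl, ih _ (Ordinal.sub_omega0_opow_log_lt hl), shiftedVeblen_zero_right]

theorem hyperexp_opow (a x : Ordinal.{u}) : hyperexp (ω ^ a) x = shiftedVeblen a x := by
  have h : (ω ^ a : Ordinal.{u}) ≠ 0 := (Ordinal.opow_pos _ Ordinal.omega0_pos).ne'
  rw [hyperexp_of_ne_zero h, Ordinal.log_opow Ordinal.one_lt_omega0, Ordinal.sub_self,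
    hyperexp_zero_left]

theorem hyperexp_one (x : Ordinal.{u}) : hyperexp 1 x = shiftedVeblen 0 x := by
  rw [← hyperexp_opow, Ordinal.opow_zero]

theorem hyperexp_shiftedVeblen {l a : Ordinal.{u}} (h : l < ω ^ a) (x : Ordinal.{u}) :
    hyperexp l (shiftedVeblen a x) = shiftedVeblen a x := by
  induction l using WellFoundedLT.induction with
  | _ l ih =>
  rcases eq_or_ne l 0 with rfl | hl
  · exact hyperexp_zero_left _
  · have hlt := Ordinal.sub_omega0_opow_log_lt hl
    rw [hyperexp_of_ne_zero hl, ih _ hlt (hlt.trans h)]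
    exact shiftedVeblen_shiftedVeblen ((Ordinal.lt_opow_iff_log_lt Ordinal.one_lt_omega0 hl).1 h) x

theorem hyperexp_add (l m x : Ordinal.{u}) : hyperexp (l + m) x = hyperexp l (hyperexp m x) := by
  induction l using WellFoundedLT.induction with
  | _ l ih =>
  rcases eq_or_ne l 0 with rfl | hl
  · rw [zero_add, hyperexp_zero_left]
  rcases lt_or_ge l (ω ^ Ordinal.log ω m) with h | h
  · -- `l` is absorbed by the leading term of `m`
    have hm : m ≠ 0 := by
      rintro rfl
      simp [hl] at h
    rw [hyperexp_of_ne_zero hm, hyperexp_shiftedVeblen h, ← hyperexp_of_ne_zero hm]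
    rw [(Ordinal.isPrincipal_add_omega0_opow _).add_eq_right_of_le h
      (Ordinal.opow_log_le_self ω hm)]
  · have hlm : l + m ≠ 0 := by simp [hl]
    have hml : Ordinal.log ω m ≤ Ordinal.log ω l :=
      Ordinal.le_log_of_opow_le Ordinal.one_lt_omega0 h
    have hlog : Ordinal.log ω (l + m) = Ordinal.log ω l := by
      apply le_antisymm
      · rw [← Order.lt_succ_iff, ← Ordinal.lt_opow_iff_log_lt Ordinal.one_lt_omega0 hlm]
        refine Ordinal.isPrincipal_add_omega0_opow _
          (Ordinal.lt_opow_succ_log_self Ordinal.one_lt_omega0 l)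
          (Ordinal.lt_opow_of_log_lt Ordinal.one_lt_omega0 (Order.lt_succ_iff.2 hml))
      · exact Ordinal.log_mono_right ω le_self_add
    rw [hyperexp_of_ne_zero hlm, hlog, hyperexp_of_ne_zero hl,
      ← ih _ (Ordinal.sub_omega0_opow_log_lt hl)]
    congr 2
    generalize hd : l - ω ^ Ordinal.log ω l = d
    have : ω ^ Ordinal.log ω l + d = l := by
      rw [← hd]
      exact Ordinal.add_sub_cancel_of_le (Ordinal.opow_log_le_self ω hl)
    calc l + m - ω ^ Ordinal.log ω l
        = ω ^ Ordinal.log ω l + (d + m) - ω ^ Ordinal.log ω l := by rw [← add_assoc, this]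
      _ = d + m := Ordinal.add_sub_cancel _ _

/-! ### Bounds below `Γ₀` -/

theorem veblen_lt_gamma_zero {a x : Ordinal.{u}} (ha : a < Γ₀) (hx : x < Γ₀) :
    Ordinal.veblen a x < Γ₀ := by
  rw [← Ordinal.veblen_gamma_zero 0] at hx ⊢
  rw [Ordinal.veblen_lt_veblen_iff]
  exact Or.inr (Or.inl ⟨ha, hx⟩)

theorem shiftedVeblen_lt_gamma_zero {a x : Ordinal.{u}} (ha : a < Γ₀) (hx : x < Γ₀) :
    shiftedVeblen a x < Γ₀ := by
  rw [shiftedVeblen]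
  split_ifs with h1 h2
  · exact Ordinal.gamma_pos
  · rw [← Ordinal.veblen_zero_apply]
    exact veblen_lt_gamma_zero Ordinal.gamma_pos hx
  · exact veblen_lt_gamma_zero ha ((Ordinal.sub_le_self x 1).trans_lt hx)

theorem hyperexp_lt_gamma_zero {l x : Ordinal.{u}} (hl : l < Γ₀) (hx : x < Γ₀) :
    hyperexp l x < Γ₀ := by
  induction l using WellFoundedLT.induction with
  | _ l ih =>
  rcases eq_or_ne l 0 with rfl | h0
  · rwa [hyperexp_zero_left]
  · have hlt := Ordinal.sub_omega0_opow_log_lt h0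
    rw [hyperexp_of_ne_zero h0]
    exact shiftedVeblen_lt_gamma_zero ((Ordinal.log_le_self ω l).trans_lt hl)
      (ih _ hlt (hlt.trans hl))

theorem add_lt_gamma_zero {x y : Ordinal.{u}} (hx : x < Γ₀) (hy : y < Γ₀) : x + y < Γ₀ := by
  have h : (ω ^ Γ₀ : Ordinal.{u}) = Γ₀ := by
    have := opow_veblen (a := Γ₀) Ordinal.gamma_ne_zero 0
    rwa [Ordinal.veblen_gamma_zero] at this
  have := Ordinal.isPrincipal_add_omega0_opow (Γ₀ : Ordinal.{u})
  rw [h] at this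
  exact this hx hy

/-- A fixed point `l = e^l(1)` yields a fixed point of `a ↦ φ_a(0)`, namely the leading exponent
of `l`. -/
theorem lt_hyperexp_one_of_lt_gamma_zero {l : Ordinal.{u}} (hl : l < Γ₀) : l < hyperexp l 1 := by
  rcases eq_or_ne l 0 with rfl | h0
  · rw [hyperexp_zero_left]
    exact zero_lt_one
  by_contra! hle
  have h1 : 1 ≤ hyperexp (l - ω ^ Ordinal.log ω l) 1 := (strictMono_hyperexp _).le_apply
  have h2 : shiftedVeblen (Ordinal.log ω l) 1 ≤ l := by
    rw [hyperexp_of_ne_zero h0] at hle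
    exact ((strictMono_shiftedVeblen _).monotone h1).trans hle
  have h3 := Ordinal.lt_opow_succ_log_self Ordinal.one_lt_omega0 l
  rcases eq_or_ne (Ordinal.log ω l) 0 with ha | ha
  · rw [ha, shiftedVeblen_zero_left one_ne_zero] at h2
    rw [ha, Order.succ_eq_add_one, zero_add] at h3
    exact (h2.trans_lt h3).false
  · have h4 := shiftedVeblen_one_add ha 0
    rw [add_zero] at h4
    rw [h4] at h2
    have h5 := h2.trans_lt h3
    rw [← opow_veblen ha, Ordinal.opow_lt_opow_iff_right Ordinal.one_lt_omega0,
      Order.lt_succ_iff] at h5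
    exact (((Ordinal.gamma_zero_le_of_veblen_le h5).trans (Ordinal.log_le_self ω l)).trans_lt
      hl).false

/-! ### Derivations between worms -/

namespace Formula

/-- The formula with every modality `⟨l⟩` replaced by `⟨k + l⟩`. -/
def shift (k : Ordinal.{u}) : Formula.{u} → Formula.{u}
  | top => top
  | and φ ψ => and (shift k φ) (shift k ψ)
  | dia l φ => dia (k + l) (shift k φ)

end Formula

theorem Derives.shift (k : Ordinal.{u}) {φ ψ : Formula.{u}} (h : Derives φ ψ) :
    Derives (φ.shift k) (ψ.shift k) := by
  induction h with
  | refl => exact .refl _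
  | top => exact .top _
  | trans _ _ ih₁ ih₂ => exact ih₁.trans ih₂
  | and_left => exact .and_left _ _
  | and_right => exact .and_right _ _
  | and_intro _ _ ih₁ ih₂ => exact .and_intro ih₁ ih₂
  | dia_dia => exact .dia_dia _ _
  | dia_mono _ _ ih => exact .dia_mono _ ih
  | dia_le h => exact .dia_le (by gcongr) _
  | dia_and h => exact .dia_and (by gcongr) _ _

/-- The worm with every entry `l` replaced by `k + l`. -/
noncomputable def Worm.shift (k : Ordinal.{u}) (w : Worm.{u}) : Worm.{u} :=
  w.map (k + ·)

theorem Worm.toFormula_shift (k : Ordinal.{u}) (w : Worm.{u}) :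
    (w.shift k).toFormula = w.toFormula.shift k := by
  induction w with
  | nil => rfl
  | cons l w ih =>
    change Formula.dia (k + l) (Worm.toFormula (Worm.shift k w)) = _
    rw [ih]
    rfl

theorem WormLt.shift (k : Ordinal.{u}) {l : Ordinal.{u}} {v w : Worm.{u}} (h : WormLt l v w) :
    WormLt (k + l) (v.shift k) (w.shift k) := by
  unfold WormLt
  rw [Worm.toFormula_shift, Worm.toFormula_shift]
  exact Derives.shift k h

theorem WormEquiv.shift (k : Ordinal.{u}) {v w : Worm.{u}} (h : WormEquiv v w) :
    WormEquiv (v.shift k) (w.shift k) := by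
  unfold WormEquiv
  rw [Worm.toFormula_shift, Worm.toFormula_shift]
  exact ⟨h.1.shift k, h.2.shift k⟩

theorem WormEquiv.symm {v w : Worm.{u}} (h : WormEquiv v w) : WormEquiv w v :=
  ⟨h.2, h.1⟩

theorem WormLt.mono {m l : Ordinal.{u}} (hml : m ≤ l) {v w : Worm.{u}} (h : WormLt l v w) :
    WormLt m v w :=
  Derives.trans h (.dia_le hml _)

theorem WormLt.trans {l : Ordinal.{u}} {v w x : Worm.{u}} (h₁ : WormLt l v w)
    (h₂ : WormLt l w x) : WormLt l v x :=
  Derives.trans h₂ ((Derives.dia_mono l h₁).trans (.dia_dia l _))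

theorem wormLt_cons (l : Ordinal.{u}) (w : Worm.{u}) : WormLt 0 w (l :: w) :=
  .dia_le (zero_le (a := l)) _

theorem derives_append_left (v w : Worm.{u}) :
    Derives (Worm.toFormula (v ++ w)) (Worm.toFormula v) := by
  induction v with
  | nil => exact .top _
  | cons l v ih => exact .dia_mono l ih

theorem derives_append_right (v w : Worm.{u}) :
    Derives (Worm.toFormula (v ++ 0 :: w)) (Worm.toFormula (0 :: w)) := by
  induction v with
  | nil => exact .refl _
  | cons l v ih =>
    exact ((Derives.dia_mono l ih).trans (.dia_le (zero_le (a := l)) _)).trans (.dia_dia 0 _)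

theorem derives_append {v : Worm.{u}} (hv : ∀ x ∈ v, 0 < x) (w : Worm.{u}) :
    Derives ((Worm.toFormula v).and (Worm.toFormula (0 :: w))) (Worm.toFormula (v ++ 0 :: w)) := by
  induction v with
  | nil => exact .and_right _ _
  | cons l v ih =>
    exact (Derives.dia_and (hv l (by simp)) _ _).trans
      (.dia_mono l (ih fun x hx => hv x (by simp [hx])))

theorem pos_of_mem_shift_one {w : Worm.{u}} {x : Ordinal.{u}} (hx : x ∈ w.shift 1) : 0 < x := by
  obtain ⟨y, -, rfl⟩ := List.mem_map.1 hx
  exact zero_lt_one.trans_le le_self_add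

/-- A strictly larger entry implies the consistency, relative to it, of every smaller one. -/
theorem wormLt_singleton {m l : Ordinal.{u}} (h : m < l) : WormLt 0 [m] [l] := by
  have h1 : Derives (Formula.dia l .top) (Formula.dia l (Formula.and .top (Formula.dia m .top))) :=
    (Derives.and_intro (.refl _) (.dia_le h.le _)).trans (.dia_and h _ _)
  exact h1.trans ((Derives.dia_mono l (.and_right _ _)).trans (.dia_le (zero_le (a := l)) _))

/-! ### The explicit order-type of a worm -/

/-- The least entry of a worm (`0` for the empty worm). -/
noncomputable def Worm.minEntry (w : Worm.{u}) : Ordinal.{u} :=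
  sInf {x | x ∈ w}

theorem Worm.minEntry_mem {w : Worm.{u}} (hw : w ≠ []) : w.minEntry ∈ w :=
  csInf_mem (s := {x | x ∈ w}) (List.exists_mem_of_ne_nil w hw)

theorem Worm.minEntry_le {w : Worm.{u}} {x : Ordinal.{u}} (hx : x ∈ w) : w.minEntry ≤ x :=
  csInf_le' (s := {x | x ∈ w}) hx

/-- The worm with its least entry subtracted (on the left) from every entry. -/
noncomputable def Worm.unshift (w : Worm.{u}) : Worm.{u} :=
  w.map (· - w.minEntry)

theorem Worm.shift_unshift (w : Worm.{u}) : w.unshift.shift w.minEntry = w := by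
  rw [shift, unshift, List.map_map]
  conv_rhs => rw [← List.map_id w]
  refine List.map_congr_left fun x hx => ?_
  exact Ordinal.add_sub_cancel_of_le (minEntry_le hx)

theorem Worm.zero_mem_unshift {w : Worm.{u}} (hw : w ≠ []) : 0 ∈ w.unshift :=
  List.mem_map.2 ⟨_, minEntry_mem hw, Ordinal.sub_self _⟩

theorem Worm.minEntry_shift (k : Ordinal.{u}) {w : Worm.{u}} (hw : w ≠ []) :
    (w.shift k).minEntry = k + w.minEntry := by
  apply le_antisymm
  · exact minEntry_le (List.mem_map.2 ⟨_, minEntry_mem hw, rfl⟩)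
  · have : w.shift k ≠ [] := by simpa [shift] using hw
    obtain ⟨y, hy, h⟩ := List.mem_map.1 (minEntry_mem this)
    refine le_of_le_of_eq ?_ h
    have := minEntry_le hy
    gcongr

theorem Worm.unshift_shift (k : Ordinal.{u}) (w : Worm.{u}) :
    (w.shift k).unshift = w.unshift := by
  rcases eq_or_ne w [] with rfl | hw
  · rfl
  · rw [unshift, minEntry_shift k hw, shift, unshift, List.map_map]
    refine List.map_congr_left fun x _ => ?_
    exact Ordinal.add_sub_add_cancel k x _

/-- The part of a worm before its first entry `0`. -/
noncomputable def Worm.head (w : Worm.{u}) : Worm.{u} :=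
  w.takeWhile (· ≠ 0)

/-- The part of a worm behind its first entry `0`. -/
noncomputable def Worm.body (w : Worm.{u}) : Worm.{u} :=
  (w.dropWhile (· ≠ 0)).tail

theorem Worm.head_append_body {w : Worm.{u}} (hw : 0 ∈ w) : w.head ++ 0 :: w.body = w := by
  have h1 : w.dropWhile (· ≠ 0) ≠ [] := by
    rw [Ne, List.dropWhile_eq_nil_iff]
    intro h
    simpa using h 0 hw
  have h2 := List.head_dropWhile_not (· ≠ (0 : Ordinal.{u})) h1
  conv_rhs => rw [← List.takeWhile_append_dropWhile (p := (· ≠ 0)) (l := w)]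
  rw [head, body]
  congr 1
  conv_rhs => rw [← List.cons_head_tail h1]
  congr 1
  symm
  simpa using h2

theorem Worm.head_append {v : Worm.{u}} (hv : ∀ x ∈ v, 0 < x) (w : Worm.{u}) :
    Worm.head (v ++ 0 :: w) = v := by
  rw [head, List.takeWhile_append_of_pos (fun x hx => by simpa using (hv x hx).ne')]
  simp

theorem Worm.body_append {v : Worm.{u}} (hv : ∀ x ∈ v, 0 < x) (w : Worm.{u}) :
    Worm.body (v ++ 0 :: w) = w := by
  rw [body, List.dropWhile_append_of_pos (fun x hx => by simpa using (hv x hx).ne')]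
  simp

theorem Worm.length_head_body {w : Worm.{u}} (hw : 0 ∈ w) :
    w.head.length + w.body.length + 1 = w.length := by
  conv_rhs => rw [← head_append_body hw]
  simp only [List.length_append, List.length_cons]
  omega

theorem Worm.length_unshift (w : Worm.{u}) : w.unshift.length = w.length := by
  simp [unshift]

/-- The order-type of a worm, computed from its shape. Shifting a worm by `k` applies the
hyperexponential `e^k`, so that the least entry may be taken to be `0`; and the worm
`v₁ 0 w` with all entries of `v₁` positive, say `v₁ = 1 ↑ v`, has the order-type
`o(w) + 1 + e^1(o(v)) = o(w) + ω ^ o(v)`. -/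
noncomputable def Worm.ord (w : Worm.{u}) : Ordinal.{u} :=
  if _ : w = [] then 0
  else hyperexp w.minEntry
    (Worm.ord w.unshift.body + ω ^ Worm.ord (w.unshift.head.map (· - 1)))
termination_by w.length
decreasing_by
  · have := length_head_body (zero_mem_unshift ‹_›)
    rw [length_unshift] at this
    omega
  · have := length_head_body (zero_mem_unshift ‹_›)
    rw [length_unshift] at this
    rw [List.length_map]
    omega

theorem Worm.ord_nil : Worm.ord ([] : Worm.{u}) = 0 := by
  rw [ord, dif_pos rfl]

theorem Worm.ord_of_ne_nil {w : Worm.{u}} (h : w ≠ []) :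
    w.ord = hyperexp w.minEntry
      (Worm.ord w.unshift.body + ω ^ Worm.ord (w.unshift.head.map (· - 1))) := by
  rw [ord, dif_neg h]

theorem Worm.ord_shift (k : Ordinal.{u}) (w : Worm.{u}) :
    (w.shift k).ord = hyperexp k w.ord := by
  rcases eq_or_ne w [] with rfl | hw
  · rw [shift, List.map_nil, ord_nil, hyperexp_zero_right]
  · have : w.shift k ≠ [] := by simpa [shift] using hw
    rw [ord_of_ne_nil this, ord_of_ne_nil hw, minEntry_shift k hw, unshift_shift, hyperexp_add]

theorem Worm.ord_append (v w : Worm.{u}) :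
    Worm.ord (v.shift 1 ++ 0 :: w) = w.ord + ω ^ v.ord := by
  have hm : Worm.minEntry (v.shift 1 ++ 0 :: w) = 0 := by
    simpa using minEntry_le (w := v.shift 1 ++ 0 :: w) (x := 0) (by simp)
  have hu : Worm.unshift (v.shift 1 ++ 0 :: w) = v.shift 1 ++ 0 :: w := by
    rw [unshift, hm]
    simp [Ordinal.sub_zero]
  have hv : ∀ x ∈ v.shift 1, 0 < x := fun x hx => pos_of_mem_shift_one hx
  rw [ord_of_ne_nil (by simp), hm, hyperexp_zero_left, hu, body_append hv, head_append hv]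
  congr 3
  rw [shift, List.map_map]
  conv_rhs => rw [← List.map_id v]
  exact List.map_congr_left fun x _ => Ordinal.add_sub_cancel 1 x

theorem Worm.shift_one_sub_one {w : Worm.{u}} (hw : ∀ x ∈ w, x ≠ 0) :
    Worm.shift 1 (w.map (· - 1)) = w := by
  rw [shift, List.map_map]
  conv_rhs => rw [← List.map_id w]
  refine List.map_congr_left fun x hx => ?_
  exact Ordinal.add_sub_cancel_of_le (Order.one_le_iff_ne_zero.2 (hw x hx))

/-- Decomposition of a worm into the part before its first `0`, which is a worm shifted by `1`, and
the rest `r`, which is empty or starts with `0`; `c` is the order-type of `r`. -/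
theorem Worm.exists_decomposition (w : Worm.{u}) :
    ∃ (h r : Worm.{u}) (c : Ordinal.{u}), w = h.shift 1 ++ r ∧
      w.ord = c + shiftedVeblen 0 h.ord ∧ (0 ∈ w → h.length < w.length) ∧
      h.length ≤ w.length ∧
      ((r = [] ∧ c = 0) ∨ ∃ b, r = 0 :: b ∧ c = Worm.ord b + 1 ∧ b.length < w.length) := by
  by_cases h0 : 0 ∈ w
  · have hne : ∀ x ∈ w.head, x ≠ 0 := fun x hx => by simpa using List.mem_takeWhile_imp hx
    have hlen := length_head_body h0
    refine ⟨w.head.map (· - 1), 0 :: w.body, w.body.ord + 1, ?_, ?_, fun _ => ?_, ?_,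
      Or.inr ⟨_, rfl, rfl, by omega⟩⟩
    · rw [shift_one_sub_one hne, head_append_body h0]
    · conv_lhs => rw [← head_append_body h0, ← shift_one_sub_one hne, ord_append]
      rw [add_assoc]
      congr 1
      rcases eq_or_ne (Worm.ord (w.head.map (· - 1))) 0 with h | h
      · rw [h, shiftedVeblen_zero_right, Ordinal.opow_zero, add_zero]
      · rw [shiftedVeblen_zero_left h]
        exact ((Ordinal.isPrincipal_add_omega0_opow _).add_eq_right
          (one_lt_omega0_opow_of_ne_zero h)).symm
    · rw [List.length_map]
      omega
    · rw [List.length_map]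
      omega
  · have hs := shift_one_sub_one (w := w) fun x hx => by
      rintro rfl
      exact h0 hx
    refine ⟨w.map (· - 1), [], 0, ?_, ?_, fun h => absurd h h0, by simp, Or.inl ⟨rfl, rfl⟩⟩
    · rw [hs, List.append_nil]
    · conv_lhs => rw [← hs, ord_shift, hyperexp_one]
      rw [zero_add]

/-! ### Comparison of worms -/

theorem exists_le_add_of_lt_add_opow {c d x : Ordinal.{u}} (hx : x ≠ 0)
    (h : c = 0 ∨ ∃ a, c = a + 1 ∧ a < d + shiftedVeblen 0 x) : ∃ e < ω ^ x, c ≤ d + e := by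
  have hp := Ordinal.isPrincipal_add_omega0_opow x
  have h1 := one_lt_omega0_opow_of_ne_zero hx
  rcases h with rfl | ⟨a, rfl, ha⟩
  · exact ⟨1, h1, zero_le⟩
  · rw [shiftedVeblen_zero_left hx] at ha
    refine ⟨a - d + 1, hp ?_ h1, ?_⟩
    · rcases le_total d a with hda | had
      · rwa [← add_lt_add_iff_left d, Ordinal.add_sub_cancel_of_le hda]
      · rw [Ordinal.sub_eq_zero_iff_le.2 had]
        exact zero_lt_one.trans h1
    · rw [← add_assoc]
      gcongr
      exact Ordinal.le_add_sub a d

theorem add_shiftedVeblen_zero_le {c d x : Ordinal.{u}}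
    (h : c = 0 ∨ ∃ a, c = a + 1 ∧ a < d + shiftedVeblen 0 x) :
    c + shiftedVeblen 0 x ≤ d + shiftedVeblen 0 x := by
  rcases eq_or_ne x 0 with rfl | hx
  · simp only [shiftedVeblen_zero_right, add_zero] at h ⊢
    rcases h with rfl | ⟨a, rfl, ha⟩
    · exact zero_le
    · exact Order.add_one_le_of_lt ha
  · obtain ⟨e, he, hc⟩ := exists_le_add_of_lt_add_opow hx h
    rw [shiftedVeblen_zero_left hx]
    calc c + ω ^ x ≤ d + e + ω ^ x := by gcongr
      _ = d + ω ^ x := by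
        rw [add_assoc, (Ordinal.isPrincipal_add_omega0_opow x).add_eq_right he]

theorem add_shiftedVeblen_zero_lt {c d x y : Ordinal.{u}} (hyx : y < x)
    (h : c = 0 ∨ ∃ a, c = a + 1 ∧ a < d + shiftedVeblen 0 x) :
    c + shiftedVeblen 0 y < d + shiftedVeblen 0 x := by
  have hx : x ≠ 0 := hyx.ne_bot
  obtain ⟨e, he, hc⟩ := exists_le_add_of_lt_add_opow hx h
  have hlt := strictMono_shiftedVeblen 0 hyx
  rw [shiftedVeblen_zero_left hx] at hlt ⊢
  calc c + shiftedVeblen 0 y ≤ d + e + shiftedVeblen 0 y := by gcongr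
    _ = d + (e + shiftedVeblen 0 y) := add_assoc _ _ _
    _ < d + ω ^ x := by
      rw [add_lt_add_iff_left]
      exact Ordinal.isPrincipal_add_omega0_opow x he hlt

theorem derives_shift_one_append {φ : Formula.{u}} {h r : Worm.{u}} (hr : r = [] ∨ ∃ b, r = 0 :: b)
    (h₁ : Derives φ (h.shift 1).toFormula) (h₂ : Derives φ r.toFormula) :
    Derives φ (Worm.toFormula (h.shift 1 ++ r)) := by
  rcases hr with rfl | ⟨b, rfl⟩
  · rwa [List.append_nil]
  · exact (h₁.and_intro h₂).trans (derives_append (fun x hx => pos_of_mem_shift_one hx) b)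

theorem derives_dia_shift_one_append {φ : Formula.{u}} {h r : Worm.{u}}
    (hr : r = [] ∨ ∃ b, r = 0 :: b) (h₁ : Derives φ (.dia 1 (h.shift 1).toFormula))
    (h₂ : Derives φ r.toFormula) :
    Derives φ (.dia 0 (Worm.toFormula (h.shift 1 ++ r))) := by
  rcases hr with rfl | ⟨b, rfl⟩
  · rw [List.append_nil]
    exact h₁.trans (.dia_le zero_le _)
  · refine (h₁.and_intro h₂).trans ((Derives.dia_and zero_lt_one _ _).trans ?_)
    exact (Derives.dia_mono 1 (derives_append (fun x hx => pos_of_mem_shift_one hx) b)).trans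
      (.dia_le zero_le _)

/-- The trichotomy of two worms, decided by the order-types. -/
def Worm.Comparable (v w : Worm.{u}) : Prop :=
  (WormLt 0 v w ∧ v.ord < w.ord) ∨ (WormEquiv v w ∧ v.ord = w.ord) ∨
    (WormLt 0 w v ∧ w.ord < v.ord)

theorem Worm.Comparable.symm {v w : Worm.{u}} (h : v.Comparable w) : w.Comparable v := by
  rcases h with h | ⟨h, h'⟩ | h
  · exact Or.inr (Or.inr h)
  · exact Or.inr (Or.inl ⟨h.symm, h'.symm⟩)
  · exact Or.inl h

theorem Worm.Comparable.shift (k : Ordinal.{u}) {v w : Worm.{u}} (h : v.Comparable w) :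
    (v.shift k).Comparable (w.shift k) := by
  unfold Comparable
  rw [ord_shift, ord_shift, (strictMono_hyperexp k).lt_iff_lt, (strictMono_hyperexp k).lt_iff_lt,
    (strictMono_hyperexp k).injective.eq_iff]
  rcases h with ⟨h, h'⟩ | ⟨h, h'⟩ | ⟨h, h'⟩
  · exact Or.inl ⟨(h.shift k).mono zero_le, h'⟩
  · exact Or.inr (Or.inl ⟨h.shift k, h'⟩)
  · exact Or.inr (Or.inr ⟨(h.shift k).mono zero_le, h'⟩)

/-- Comparison of `v` with the rest `r` of `w = h r`: if `r = 0 b` and `v` is at most `b`, then `v`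
is below `w`; otherwise `v` implies `r`. -/
theorem wormLt_or_derives_rest {v h r : Worm.{u}} {c x : Ordinal.{u}}
    (hr : (r = [] ∧ c = 0) ∨ ∃ b, r = 0 :: b ∧ c = Worm.ord b + 1 ∧ Worm.Comparable b v) :
    (WormLt 0 v (h ++ r) ∧ v.ord < c + x) ∨
      (Derives v.toFormula r.toFormula ∧ (c = 0 ∨ ∃ a, c = a + 1 ∧ a < v.ord)) := by
  rcases hr with ⟨rfl, rfl⟩ | ⟨b, rfl, rfl, hb⟩
  · exact Or.inr ⟨.top _, Or.inl rfl⟩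
  · have hlt : Worm.ord b < Worm.ord b + 1 + x :=
      (Order.lt_add_one_iff.2 le_rfl).trans_le le_self_add
    have hd : WormLt 0 b (h ++ 0 :: b) := derives_append_right h b
    rcases hb with ⟨hb, hb'⟩ | ⟨hb, hb'⟩ | ⟨hb, hb'⟩
    · exact Or.inr ⟨hb, Or.inr ⟨_, rfl, hb'⟩⟩
    · exact Or.inl ⟨Derives.trans hd (.dia_mono 0 hb.1), hb' ▸ hlt⟩
    · exact Or.inl ⟨WormLt.trans hb hd, hb'.trans hlt⟩

/-- Any two worms are comparable, by induction on their joint length. After a shift one of them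
contains the entry `0`. If neither `v = h₁ r₁` is below the part of `w = h₂ r₂` behind the first `0`
nor vice versa, then `v ⇒ r₂` and `w ⇒ r₁`, and the comparison of `h₁` with `h₂` decides. -/
theorem Worm.comparable (v w : Worm.{u}) : v.Comparable w := by
  induction hn : v.length + w.length using Nat.strong_induction_on generalizing v w with
  | _ n ih =>
  subst hn
  wlog h0 : 0 ∈ v ∨ 0 ∈ w generalizing v w with H
  · rcases eq_or_ne (v ++ w) [] with hvw | hvw
    · obtain ⟨rfl, rfl⟩ := List.append_eq_nil_iff.1 hvw
      exact Or.inr (Or.inl ⟨⟨.refl _, .refl _⟩, rfl⟩)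
    · -- the least entry of both worms together is subtracted from all entries
      have hsplit := shift_unshift (v ++ w)
      generalize Worm.minEntry (v ++ w) = k at hsplit
      have hz := zero_mem_unshift hvw
      have hlen := length_unshift (v ++ w)
      generalize Worm.unshift (v ++ w) = x at hsplit hz hlen
      have hv : Worm.shift k (x.take v.length) = v := by
        rw [shift, List.map_take]
        change List.take v.length (Worm.shift k x) = v
        rw [hsplit, List.take_left']
        rfl
      have hw : Worm.shift k (x.drop v.length) = w := by
        rw [shift, List.map_drop]
        change List.drop v.length (Worm.shift k x) = w
        rw [hsplit, List.drop_left']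
        rfl
      have hlv : (x.take v.length).length = v.length := by
        simpa [shift] using congrArg List.length hv
      have hlw : (x.drop v.length).length = w.length := by
        simpa [shift] using congrArg List.length hw
      rw [← hv, ← hw]
      refine Comparable.shift k (H _ _ (fun m hm => ih m (by rwa [hlv, hlw] at hm)) ?_)
      rwa [← List.mem_append, List.take_append_drop]
  obtain ⟨h₁, r₁, c₁, hv, hov, hl₁, hl₁', hr₁⟩ := exists_decomposition v
  obtain ⟨h₂, r₂, c₂, hw, how, hl₂, hl₂', hr₂⟩ := exists_decomposition w
  have hr₁' : r₁ = [] ∨ ∃ b, r₁ = 0 :: b :=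
    hr₁.imp (fun h => h.1) fun ⟨b, h, _⟩ => ⟨b, h⟩
  have hr₂' : r₂ = [] ∨ ∃ b, r₂ = 0 :: b :=
    hr₂.imp (fun h => h.1) fun ⟨b, h, _⟩ => ⟨b, h⟩
  have hh := ih (h₁.length + h₂.length)
    (by rcases h0 with h | h
        · have := hl₁ h
          omega
        · have := hl₂ h
          omega) h₁ h₂ rfl
  have key₁ := wormLt_or_derives_rest (v := w) (h := h₁.shift 1) (x := shiftedVeblen 0 h₁.ord)
    (hr₁.imp_right fun ⟨b, h, h', hb⟩ => ⟨b, h, h', ih _ (by omega) b w rfl⟩)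
  have key₂ := wormLt_or_derives_rest (v := v) (h := h₂.shift 1) (x := shiftedVeblen 0 h₂.ord)
    (hr₂.imp_right fun ⟨b, h, h', hb⟩ => ⟨b, h, h', ih _ (by omega) b v rfl⟩)
  rw [← hv, ← hov] at key₁
  rw [← hw, ← how] at key₂
  rcases key₁ with key₁ | ⟨hd₁, hc₁⟩
  · exact Or.inr (Or.inr key₁)
  rcases key₂ with key₂ | ⟨hd₂, hc₂⟩
  · exact Or.inl key₂
  have hv' : Derives v.toFormula (h₁.shift 1).toFormula := by
    rw [hv]
    exact derives_append_left _ _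
  have hw' : Derives w.toFormula (h₂.shift 1).toFormula := by
    rw [hw]
    exact derives_append_left _ _
  rw [how] at hc₁
  rw [hov] at hc₂
  rcases hh with ⟨h, h'⟩ | ⟨h, h'⟩ | ⟨h, h'⟩
  · left
    have h1 := h.shift 1
    rw [add_zero] at h1
    have h2 := derives_dia_shift_one_append hr₁' (hw'.trans h1) hd₁
    rw [← hv] at h2
    refine ⟨h2, ?_⟩
    rw [hov, how]
    exact add_shiftedVeblen_zero_lt h' hc₁
  · right
    left
    have h1 := h.shift 1
    have h2 := derives_shift_one_append hr₁' (hw'.trans h1.2) hd₁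
    have h3 := derives_shift_one_append hr₂' (hv'.trans h1.1) hd₂
    rw [← hv] at h2
    rw [← hw] at h3
    refine ⟨⟨h3, h2⟩, ?_⟩
    rw [hov, how, h']
    rw [h'] at hc₂
    exact le_antisymm (add_shiftedVeblen_zero_le hc₁) (add_shiftedVeblen_zero_le hc₂)
  · right
    right
    have h1 := h.shift 1
    rw [add_zero] at h1
    have h2 := derives_dia_shift_one_append hr₂' (hv'.trans h1) hd₂
    rw [← hw] at h2
    refine ⟨h2, ?_⟩
    rw [hov, how]
    exact add_shiftedVeblen_zero_lt h' hc₂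

theorem WormLt.ord_lt {v w : Worm.{u}} (h : WormLt 0 v w) : v.ord < w.ord := by
  rcases v.comparable w with h' | ⟨h', -⟩ | ⟨h', -⟩
  · exact h'.2
  · exact absurd (Derives.trans h'.1 h) (not_wormLt_self v)
  · exact absurd (h.trans h') (not_wormLt_self v)

theorem WormEquiv.ord_eq {v w : Worm.{u}} (h : WormEquiv v w) : v.ord = w.ord := by
  rcases v.comparable w with ⟨h', -⟩ | h' | ⟨h', -⟩
  · exact absurd (Derives.trans h.1 h') (not_wormLt_self v)
  · exact h'.2
  · exact absurd (Derives.trans h.2 h') (not_wormLt_self w)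

theorem wormLe_zero_iff {v w : Worm.{u}} : WormLe 0 v w ↔ v.ord ≤ w.ord := by
  constructor
  · rintro (h | h)
    · exact h.ord_lt.le
    · exact h.ord_eq.le
  · intro h
    rcases v.comparable w with h' | h' | h'
    · exact Or.inl h'.1
    · exact Or.inr h'.1
    · exact absurd h h'.2.not_ge

theorem strictPart_wormLe_zero_iff {v w : Worm.{u}} :
    StrictPart (WormLe 0) v w ↔ v.ord < w.ord := by
  rw [StrictPart, wormLe_zero_iff, wormLe_zero_iff, lt_iff_le_not_ge]

/-! ### Every ordinal is an order-type -/

/-- The last term of the Cantor normal form of a non-zero ordinal: it is the least non-zero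
remainder, and hence additively principal. -/
theorem exists_eq_add_opow {x : Ordinal.{u}} (hx : x ≠ 0) :
    ∃ a y : Ordinal.{u}, x = a + ω ^ y ∧ a < x := by
  let S : Set Ordinal.{u} := {b | b ≠ 0 ∧ ∃ a, x = a + b}
  have hS : S.Nonempty := ⟨x, hx, 0, (zero_add x).symm⟩
  obtain ⟨hb0, a, hab⟩ := csInf_mem hS
  have hmin : ∀ b ∈ S, sInf S ≤ b := fun b hb => csInf_le' hb
  generalize sInf S = b at hb0 hab hmin
  have hp : Ordinal.IsPrincipal (· + ·) b := by
    rw [Ordinal.isPrincipal_add_iff_add_lt_ne_self]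
    intro c hc d hd hcd
    rcases eq_or_ne d 0 with rfl | hd0
    · rw [add_zero] at hcd
      exact hc.ne hcd
    · exact (hmin d ⟨hd0, a + c, by rw [add_assoc, hcd, hab]⟩).not_gt hd
  rcases Ordinal.isPrincipal_add_iff_zero_or_omega0_opow.1 hp with h | ⟨y, rfl⟩
  · exact absurd h hb0
  · refine ⟨a, y, hab, ?_⟩
    rw [hab]
    exact lt_add_of_pos_right a (pos_iff_ne_zero.2 hb0)

theorem Worm.ord_surjective : Function.Surjective (Worm.ord : Worm.{u} → Ordinal.{u}) := by
  intro x
  induction x using WellFoundedLT.induction with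
  | _ x ih =>
  rcases eq_or_ne x 0 with rfl | hx
  · exact ⟨[], ord_nil⟩
  obtain ⟨a, y, hxa, ha⟩ := exists_eq_add_opow hx
  have hyx : y ≤ x := by
    rw [hxa]
    exact (Ordinal.right_le_opow y Ordinal.one_lt_omega0).trans le_add_self
  rcases hyx.lt_or_eq with hyx | rfl
  · obtain ⟨w, hw⟩ := ih a ha
    obtain ⟨v, hv⟩ := ih y hyx
    exact ⟨v.shift 1 ++ 0 :: w, by rw [ord_append, hv, hw, hxa]⟩
  · -- `y` is an epsilon number, hence a value `φ_o(d)` with `d < y` and `o ≠ 0`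
    have hy : ω ^ y = y := by
      apply le_antisymm
      · conv_rhs => rw [hxa]
        exact le_add_self
      · exact Ordinal.right_le_opow y Ordinal.one_lt_omega0
    have h1 := Ordinal.veblen_invVeblen₁_invVeblen₂ y
    have h2 := Ordinal.invVeblen₂_lt y
    generalize Ordinal.invVeblen₁ y = o at h1
    generalize Ordinal.invVeblen₂ y = d at h1 h2
    rw [hy] at h1 h2
    have ho : o ≠ 0 := by
      rintro rfl
      rw [Ordinal.veblen_zero_apply, ← hy,
        Ordinal.opow_right_inj Ordinal.one_lt_omega0] at h1
      exact h2.ne h1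
    have hd : 1 + d < y := by
      rw [← h1, ← one_add_veblen ho, h1]
      gcongr
    obtain ⟨w, hw⟩ := ih _ hd
    exact ⟨w.shift (ω ^ o), by rw [ord_shift, hw, hyperexp_opow, shiftedVeblen_one_add ho, h1]⟩

theorem accRank_eq {α : Type*} {lt : α → α → Prop} {a : α} (h : Acc lt a) :
    accRank.{u} h = ⨆ b : {b : α // lt b a}, (accRank.{u} (h.inv b.2) + 1) := by
  cases h
  rfl

theorem accRank_eq_ord {w : Worm.{u}} (h : Acc (StrictPart (WormLe 0)) w) :
    accRank h = w.ord := by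
  induction h with
  | intro w hw ih =>
  rw [accRank_eq]
  have hle : ∀ b : {b : Worm.{u} // StrictPart (WormLe 0) b w},
      accRank (Acc.inv (Acc.intro w hw) b.2) + 1 ≤ w.ord := by
    intro b
    rw [ih b.1 b.2]
    exact Order.add_one_le_of_lt (strictPart_wormLe_zero_iff.1 b.2)
  apply le_antisymm
  · exact ciSup_le' hle
  · -- a supremum below `ord w` would itself be the value of some `v ◁ w`
    by_contra! hlt
    obtain ⟨v, hv⟩ := Worm.ord_surjective (⨆ b : {b : Worm.{u} // StrictPart (WormLe 0) b w},
      (accRank (Acc.inv (Acc.intro w hw) b.2) + 1))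
    rw [← hv] at hlt
    have hvw := strictPart_wormLe_zero_iff.2 hlt
    have := le_ciSup ⟨_, Set.forall_mem_range.2 hle⟩ (⟨v, hvw⟩ : {b // StrictPart (WormLe 0) b w})
    rw [← hv, ih v hvw] at this
    exact (Order.lt_add_one_iff.2 le_rfl).not_ge this

theorem Worm.o_eq_ord (w : Worm.{u}) : w.o = w.ord := by
  have hwf : WellFounded (StrictPart (WormLe.{u} 0)) := by
    refine Subrelation.wf (r := InvImage (· < ·) Worm.ord) ?_ (InvImage.wf _ wellFounded_lt)
    exact fun h => strictPart_wormLe_zero_iff.1 h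
  rw [o, orderRank, dif_pos (hwf.apply w), accRank_eq_ord]

/-! ### Autonomous worms -/

theorem Worm.ord_singleton (l : Ordinal.{u}) : Worm.ord [l] = hyperexp l 1 := by
  have h : Worm.ord ([0] : Worm.{u}) = 1 := by
    have := ord_append ([] : Worm.{u}) []
    rw [ord_nil, Ordinal.opow_zero, zero_add] at this
    exact this
  have h' : Worm.shift l [0] = [l] := by simp [shift]
  rw [← h', ord_shift, h]

theorem Worm.ord_singleton_le_of_mem {l : Ordinal.{u}} {w : Worm.{u}} (h : l ∈ w) :
    Worm.ord [l] ≤ w.ord := by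
  induction w with
  | nil => simp at h
  | cons m w ih =>
    rcases List.mem_cons.1 h with rfl | h
    · by_contra! hlt
      have h1 : WormLe 0 (l :: w) [l] := wormLe_zero_iff.2 hlt.le
      have h2 : Derives (Worm.toFormula (l :: w)) (Worm.toFormula [l]) := .dia_mono l (.top _)
      rcases h1 with h1 | h1
      · exact not_wormLt_self _ (Derives.trans h2 h1)
      · exact hlt.ne h1.ord_eq
    · exact (ih h).trans (wormLt_cons m w).ord_lt.le

theorem Worm.lt_gamma_zero_of_mem {l : Ordinal.{u}} {w : Worm.{u}} (hw : w.ord < Γ₀) (h : l ∈ w) :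
    l < Γ₀ := by
  have hmono : StrictMono fun l : Ordinal.{u} => Worm.ord [l] := fun _ _ h =>
    (wormLt_singleton h).ord_lt
  exact (hmono.le_apply.trans (ord_singleton_le_of_mem h)).trans_lt hw

theorem Worm.lt_ord_of_mem {l : Ordinal.{u}} {w : Worm.{u}} (hw : w.ord < Γ₀) (h : l ∈ w) :
    l < w.ord := by
  have h1 := lt_hyperexp_one_of_lt_gamma_zero (lt_gamma_zero_of_mem hw h)
  rw [← ord_singleton] at h1
  exact h1.trans_le (ord_singleton_le_of_mem h)

theorem Worm.ord_lt_gamma_zero {w : Worm.{u}} (hw : ∀ l ∈ w, l < Γ₀) : w.ord < Γ₀ := by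
  induction hn : w.length using Nat.strong_induction_on generalizing w with
  | _ n ih =>
  subst hn
  rcases eq_or_ne w [] with rfl | hne
  · rw [ord_nil]
    exact Ordinal.gamma_pos
  have hu : ∀ l ∈ w.unshift, l < Γ₀ := by
    intro l hl
    obtain ⟨x, hx, rfl⟩ := List.mem_map.1 hl
    exact (Ordinal.sub_le_self _ _).trans_lt (hw x hx)
  have hlen := length_head_body (zero_mem_unshift hne)
  rw [length_unshift] at hlen
  rw [ord_of_ne_nil hne]
  refine hyperexp_lt_gamma_zero (hw _ (minEntry_mem hne)) (add_lt_gamma_zero ?_ ?_)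
  · refine ih _ (by omega) (fun l hl => hu l ?_) rfl
    exact (List.dropWhile_sublist _).subset (List.mem_of_mem_tail hl)
  · rw [← Ordinal.veblen_zero_apply]
    refine veblen_lt_gamma_zero Ordinal.gamma_pos (ih _ ?_ (fun l hl => ?_) rfl)
    · rw [List.length_map]
      omega
    · obtain ⟨x, hx, rfl⟩ := List.mem_map.1 hl
      exact (Ordinal.sub_le_self _ _).trans_lt (hu x ((List.takeWhile_sublist _).subset hx))

theorem AutWorm.lt_gamma_zero_of_mem_toWorm (w : AutWorm) :
    ∀ l ∈ AutWorm.toWorm.{u} w, l < Γ₀ := by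
  induction w with
  | top => simp [toWorm]
  | paren w v ihw ihv =>
    intro l hl
    rcases List.mem_cons.1 hl with rfl | hl
    · rw [Worm.o_eq_ord]
      exact Worm.ord_lt_gamma_zero ihw
    · exact ihv l hl

theorem AutWorm.exists_toWorm_eq (w : Worm.{u}) (hw : ∀ l ∈ w, ∃ v : AutWorm, l = AutWorm.o v) :
    ∃ v : AutWorm, v.toWorm = w := by
  induction w with
  | nil => exact ⟨top, rfl⟩
  | cons l w ih =>
    obtain ⟨v, hv⟩ := ih fun x hx => hw x (by simp [hx])
    obtain ⟨x, hx⟩ := hw l (by simp)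
    refine ⟨paren x v, ?_⟩
    rw [toWorm, hv, hx]
    rfl

theorem AutWorm.exists_eq_o {x : Ordinal.{u}} (hx : x < Γ₀) : ∃ w : AutWorm, x = AutWorm.o w := by
  induction x using WellFoundedLT.induction with
  | _ x ih =>
  obtain ⟨w, rfl⟩ := Worm.ord_surjective x
  obtain ⟨v, hv⟩ := exists_toWorm_eq w fun l hl =>
    ih l (Worm.lt_ord_of_mem hx hl) (Worm.lt_gamma_zero_of_mem hx hl)
  exact ⟨v, by rw [o, hv, Worm.o_eq_ord]⟩

end ReflectionCalculus

theorem mainTheorem7 (γ : Ordinal.{u}) :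
    γ < Γ₀ ↔ ∃ w : ReflectionCalculus.AutWorm, γ = ReflectionCalculus.AutWorm.o.{u} w := by
  refine ⟨ReflectionCalculus.AutWorm.exists_eq_o, ?_⟩
  rintro ⟨w, rfl⟩
  rw [ReflectionCalculus.AutWorm.o, ReflectionCalculus.Worm.o_eq_ord]
  exact ReflectionCalculus.Worm.ord_lt_gamma_zero
    (ReflectionCalculus.AutWorm.lt_gamma_zero_of_mem_toWorm w)
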